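/- Let $n\ge 1$, $d\ge 2$, and let $|\psi\rangle_{A_1\cdots A_n}=\sqrt p\,|W_n^d\rangle+\sqrt{1-p}\,|0\cdots0\rangle\in(\mathbb C^d)^{\otimes n}$ with $0\le p\le 1$ be a superposition of a generalized $W$-class state $$|W_n^d\rangle=\sum_{i=1}^{d-1}\big(a_{1i}|i0\cdots0\rangle+a_{2i}|0i0\cdots0\rangle+\cdots+a_{ni}|0\cdots0i\rangle\big),\qquad \sum_{s=1}^n\sum_{i=1}^{d-1}|a_{si}|^2=1,$$ and the vacuum (a GWV state). For $q>0$, $q\ne1$, the Tsallis-$q$ entropy of a density matrix $\rho$ is $S_q(\rho)=\frac{1-\operatorname{tr}\rho^q}{q-1}$, and $S_1(\rho)=\lim_{q\to1}S_q(\rho)=-\operatorname{tr}\rho\ln\rho$. For a bipartite pure state put $T_q(|\phi\rangle_{AB})=S_q(\operatorname{tr}_B|\phi\rangle\langle\phi|)$, and for a bipartite mixed state let $$T_q^a(\rho_{A|B})=\max\Big\{\sum_i p_iT_q(|\phi_i\rangle):\ \rho_{AB}=\sum_i p_i|\phi_i\rangle\langle\phi_i|\Big\}$$ be its Tsallis-$q$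 entanglement of assistance, the maximum being over all (finite) pure state decompositions of $\rho_{AB}$. Let $r\ge3$ and let $P,P_0,\dots,P_{r-1}$ be pairwise disjoint nonempty subsets of $\{A_1,\dots,A_n\}$. For disjoint sets $X,Y$ of parties, $\rho_{X|Y}$ denotes the reduced state of $|\psi\rangle\langle\psi|$ on $X\cup Y$, regarded as a bipartite state with respect to the cut $X|Y$; write $\rho_{PP_j}=\rho_{P|P_j}$ and $\rho_{P|P_i\cdots P_{r-1}}=\rho_{P|P_i\cup\cdots\cup P_{r-1}}$. Let $q\in\big[\frac{5-\sqrt{13}}2,2\big]\cup\big[3,\frac{5+\sqrt{13}}2\big]$, $\mu\in(0,1]$, $0<k\le1$, let $t$ be an integer with $0\le t\le r-3$, and put $\mathcal K_\mu=\frac{(1+k)^\mu-1}{k^\mu}$. Assume that $$k\,T_q^a(\rho_{PP_i})\ge T_q^a(\rho_{P|P_{i+1}\cdots P_{r-1}})\quad (i=0,1,\dots,t),\qquad T_q^a(\rho_{PP_j})\le k\,T_q^a(\rho_{P|P_{j+1}\cdots P_{r-1}})\quad (j=t+1,\dots,r-2).$$ Then $$\big[T_q^a(\rho_{P|P_0\cdots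 P_{r-1}})\big]^\mu\le\sum_{j=0}^{t}\mathcal K_\mu^{\,j}\big[T_q^a(\rho_{PP_j})\big]^\mu+\mathcal K_\mu^{\,t+2}\sum_{j=t+1}^{r-2}\big[T_q^a(\rho_{PP_j})\big]^\mu+\mathcal K_\mu^{\,t+1}\big[T_q^a(\rho_{PP_{r-1}})\big]^\mu .$$ -/

import Mathlib

open scoped BigOperators

/-! ### Bipartite pure and mixed states on `ℂ^α ⊗ ℂ^β` -/

/-- The reduced density matrix `ρ_A = tr_B |φ⟩⟨φ|` of a bipartite vector `φ ∈ ℂ^α ⊗ ℂ^β`. -/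
noncomputable def reducedA {α β : Type*} [Fintype β] (φ : α × β → ℂ) : Matrix α α ℂ :=
  Matrix.of fun a a' => ∑ b, φ (a, b) * star (φ (a', b))

theorem reducedA_isHermitian {α β : Type*} [Fintype β] (φ : α × β → ℂ) :
    (reducedA φ).IsHermitian := by
  ext a a'
  simp [reducedA, Matrix.conjTranspose_apply, mul_comm]

/-- The Tsallis-`q` entropy of a density matrix, `S_q(ρ) = (1 - tr ρ^q) / (q - 1)`, where
`tr ρ^q` is the sum of the `q`-th powers of the eigenvalues. At `q = 1` it is the limit of these
values, the von Neumann entropy `-tr (ρ log ρ)` (natural logarithm). -/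
noncomputable def tsallisEntropy {α : Type*} [Fintype α] [DecidableEq α] (q : ℝ)
    {ρ : Matrix α α ℂ} (hρ : ρ.IsHermitian) : ℝ :=
  if q = 1 then ∑ i, -(hρ.eigenvalues i * Real.log (hρ.eigenvalues i))
  else (1 - ∑ i, hρ.eigenvalues i ^ q) / (q - 1)

/-- The Tsallis-`q` entanglement of a bipartite pure state, `T_q(|φ⟩) = S_q(ρ_A)`. -/
noncomputable def tsallisPure {α β : Type*} [Fintype α] [DecidableEq α] [Fintype β] (q : ℝ)
    (φ : α × β → ℂ) : ℝ :=
  tsallisEntropy q (reducedA_isHermitian φ)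

/-- `{p_i, |φ_i⟩}` is a pure state decomposition of `ρ`: the `p_i` are probabilities,
the `φ_i` are unit vectors, and `ρ = ∑ p_i |φ_i⟩⟨φ_i|`. -/
def IsPureDecomposition {α β : Type*} [Fintype α] [Fintype β]
    (ρ : Matrix (α × β) (α × β) ℂ) {m : ℕ} (p : Fin m → ℝ) (φ : Fin m → α × β → ℂ) : Prop :=
  (∀ i, 0 ≤ p i) ∧ (∑ i, p i = 1) ∧ (∀ i, ∑ x, ‖φ i x‖ ^ 2 = 1) ∧
    ρ = ∑ i, (p i : ℂ) • Matrix.vecMulVec (φ i) (star (φ i))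

/-- The Tsallis-`q` entanglement of assistance of a bipartite mixed state: the largest average
`∑ p_i T_q(|φ_i⟩)` over all pure state decompositions `{p_i, |φ_i⟩}` of `ρ`. -/
noncomputable def tsallisAssist {α β : Type*} [Fintype α] [DecidableEq α] [Fintype β] (q : ℝ)
    (ρ : Matrix (α × β) (α × β) ℂ) : ℝ :=
  sSup {v : ℝ | ∃ (m : ℕ) (p : Fin m → ℝ) (φ : Fin m → α × β → ℂ),
    IsPureDecomposition ρ p φ ∧ v = ∑ i, p i * tsallisPure q (φ i)}

/-! ### Multiqudit states. The basis vectors of `(ℂ^d)^{⊗ n}` are the maps `Fin n → Fin d`. -/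

/-- The generalized `W`-class vector
`∑_{i=1}^{d-1} (a_{1i} |i0⋯0⟩ + a_{2i} |0i0⋯0⟩ + ⋯ + a_{ni} |0⋯0i⟩)`. -/
noncomputable def gwVector {n d : ℕ} [NeZero d] (a : Fin n → Fin d → ℂ) :
    (Fin n → Fin d) → ℂ :=
  ∑ i ∈ Finset.univ.filter (fun i : Fin d => i ≠ 0), ∑ s : Fin n,
    a s i • (Pi.single (Pi.single s i : Fin n → Fin d) (1 : ℂ) : (Fin n → Fin d) → ℂ)

/-- The vacuum `|0⋯0⟩`. -/
noncomputable def vacuum (n d : ℕ) [NeZero d] : (Fin n → Fin d) → ℂ :=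
  Pi.single (0 : Fin n → Fin d) (1 : ℂ)

/-- GWV states: `ψ = √p |W_n^d⟩ + √(1-p) |0⋯0⟩` with `0 ≤ p ≤ 1` and `|W_n^d⟩` a normalized
generalized `W`-class state. -/
def IsGWV {n d : ℕ} [NeZero d] (ψ : (Fin n → Fin d) → ℂ) : Prop :=
  ∃ (p : ℝ) (a : Fin n → Fin d → ℂ), 0 ≤ p ∧ p ≤ 1 ∧
    (∑ s : Fin n, ∑ i ∈ Finset.univ.filter (fun i : Fin d => i ≠ 0), ‖a s i‖ ^ 2 = 1) ∧
    ψ = ((√p : ℝ) : ℂ) • gwVector a + ((√(1 - p) : ℝ) : ℂ) • vacuum n d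

/-- The configuration of all `n` parties that is `x` on `P`, `y` on `Q` and `z` on the rest. -/
def assemble {n d : ℕ} (P Q : Finset (Fin n)) (x : P → Fin d) (y : Q → Fin d)
    (z : {s : Fin n // s ∉ P ∪ Q} → Fin d) : Fin n → Fin d := fun s =>
  if hP : s ∈ P then x ⟨s, hP⟩
  else if hQ : s ∈ Q then y ⟨s, hQ⟩
  else z ⟨s, by simp [hP, hQ]⟩

/-- For disjoint sets `P`, `Q` of parties, the reduced density matrix of `|ψ⟩⟨ψ|` on the parties
in `P ∪ Q` (all other parties are traced out), as a bipartite state across the cut `P|Q`. -/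
noncomputable def reducedState {n d : ℕ} (ψ : (Fin n → Fin d) → ℂ) (P Q : Finset (Fin n)) :
    Matrix ((P → Fin d) × (Q → Fin d)) ((P → Fin d) × (Q → Fin d)) ℂ :=
  Matrix.of fun u v => ∑ z : {s : Fin n // s ∉ P ∪ Q} → Fin d,
    ψ (assemble P Q u.1 u.2 z) * star (ψ (assemble P Q v.1 v.2 z))

/-- `T_q^a(ρ_{P|Q})` for the reduced state of `ψ` on `P ∪ Q`. -/
noncomputable def Tqa {n d : ℕ} (q : ℝ) (ψ : (Fin n → Fin d) → ℂ) (P Q : Finset (Fin n)) : ℝ :=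
  tsallisAssist q (reducedState ψ P Q)

/-- The union `P_i ∪ P_{i+1} ∪ ⋯ ∪ P_{r-1}`. -/
def tailUnion {n : ℕ} (r : ℕ) (Q : ℕ → Finset (Fin n)) (i : ℕ) : Finset (Fin n) :=
  (Finset.Ico i r).biUnion Q

/-- The weight `K_μ = ((1 + k)^μ - 1) / k^μ`. -/
noncomputable def Kweight (k μ : ℝ) : ℝ := ((1 + k) ^ μ - 1) / k ^ μ

/-! The core is plain polygamy, `Tqa_union_le_add`: assistance across `P|QR` is at most the sum of
those across `P|Q` and `P|R`. The weights then come from a scalar power inequality applied along the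
chain of tails.

For polygamy, a reduced GWV state is a W-type vector `|w⟩|0⟩ + |0⟩|v⟩ + b|0⟩|0⟩` mixed with the
vacuum, so its support lies in the span of `|w⟩|0⟩ + |0⟩|v⟩` and the vacuum. Hence every member of
every pure decomposition has coefficients `(x, y)` in these two vectors, and its entanglement is a
function `tangleTsallis q` of the tangle `4‖xw‖²‖xv‖²` alone (`tsallisPure_wVec`). Splitting `v`
into the parts on `Q` and on `R` splits this tangle additively. The function is concave in the
tangle and vanishes at `0`, hence is subadditive (`tangleTsallis_add_le`). It remains to realize
both pieces by genuine decompositions of the smaller states: tracing out a block adds vacuum weight,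
which is absorbed by replacing each `y` with `y ± z`, without changing `x` or the tangle
(`sum_tangleTsallis_le_tsallisAssist`).

Concavity comes from the sign of the third derivative of the binary entropy, which is where `q ≤ 2`
or `3 ≤ q` enters. Finally `(x + y)^μ ≤ x^μ + K y^μ` for `y ≤ k x` puts one factor `K` on the
smaller term at each step: on the tail for the first `t + 1` blocks, on the single block afterwards.
-/

/-! ### Calculus of the binary Tsallis entropy. -/

/-- The summand of the Tsallis-`q` entropy of a probability vector. -/
noncomputable def tsallisSummand (q t : ℝ) : ℝ :=
  if q = 1 then -(t * Real.log t) else (t - t ^ q) / (q - 1)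

theorem tsallisSummand_zero {q : ℝ} (hq : 0 < q) : tsallisSummand q 0 = 0 := by
  simp [tsallisSummand, Real.zero_rpow hq.ne']

theorem tsallisSummand_one (q : ℝ) : tsallisSummand q 1 = 0 := by
  simp [tsallisSummand]

theorem tsallisSummand_nonneg {q t : ℝ} (h0 : 0 ≤ t) (h1 : t ≤ 1) (hq : 0 < q) :
    0 ≤ tsallisSummand q t := by
  unfold tsallisSummand
  split_ifs with h
  · have := Real.mul_log_nonpos h0 h1
    linarith
  · rcases h0.eq_or_lt with rfl | h0
    · simp [Real.zero_rpow hq.ne']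
    rcases lt_or_gt_of_ne h with h | h
    · have := Real.rpow_le_rpow_of_exponent_ge h0 h1 h.le
      rw [Real.rpow_one] at this
      exact div_nonneg_of_nonpos (by linarith) (by linarith)
    · have := Real.rpow_le_rpow_of_exponent_ge h0 h1 h.le
      rw [Real.rpow_one] at this
      exact div_nonneg (by linarith) (by linarith)

theorem continuous_tsallisSummand {q : ℝ} (hq : 0 < q) : Continuous (tsallisSummand q) := by
  unfold tsallisSummand
  split_ifs with h
  · exact Real.continuous_mul_log.neg
  · exact (continuous_id.sub (Real.continuous_rpow_const hq.le)).div_const _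

/-- The first derivative of `tsallisSummand q` at positive arguments. -/
noncomputable def tsallisSummandDeriv (q t : ℝ) : ℝ :=
  if q = 1 then -(Real.log t + 1) else (1 - q * t ^ (q - 1)) / (q - 1)

theorem hasDerivAt_tsallisSummand (q : ℝ) {t : ℝ} (ht : 0 < t) :
    HasDerivAt (tsallisSummand q) (tsallisSummandDeriv q t) t := by
  unfold tsallisSummand tsallisSummandDeriv
  split_ifs with h
  · exact (Real.hasDerivAt_mul_log ht.ne').neg
  · exact ((hasDerivAt_id t).sub (Real.hasDerivAt_rpow_const (Or.inl ht.ne'))).div_const _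

theorem hasDerivAt_tsallisSummandDeriv (q : ℝ) {t : ℝ} (ht : 0 < t) :
    HasDerivAt (tsallisSummandDeriv q) (-(q * t ^ (q - 2))) t := by
  unfold tsallisSummandDeriv
  split_ifs with h
  · subst h
    refine HasDerivAt.congr_deriv (((Real.hasDerivAt_log ht.ne').add_const 1).neg) ?_
    rw [show (1 : ℝ) - 2 = -1 by norm_num, Real.rpow_neg_one, one_mul]
  · have hq : q - 1 ≠ 0 := sub_ne_zero.2 h
    refine HasDerivAt.congr_deriv ((((Real.hasDerivAt_rpow_const (p := q - 1) (Or.inl ht.ne')).const_mul q).const_sub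
      1).div_const (q - 1)) ?_
    rw [show q - 1 - 1 = q - 2 by ring]
    field_simp

/-- The Tsallis-`q` entropy of the spectrum `(1 ± u) / 2`. -/
noncomputable def binaryTsallis (q u : ℝ) : ℝ :=
  tsallisSummand q ((1 + u) / 2) + tsallisSummand q ((1 - u) / 2)

/-- The derivative of `binaryTsallis q`. -/
noncomputable def binaryTsallisDeriv (q u : ℝ) : ℝ :=
  (tsallisSummandDeriv q ((1 + u) / 2) - tsallisSummandDeriv q ((1 - u) / 2)) / 2

/-- The second derivative of `binaryTsallis q`. -/
noncomputable def binaryTsallisDeriv₂ (q u : ℝ) : ℝ :=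
  -(q * (((1 + u) / 2) ^ (q - 2) + ((1 - u) / 2) ^ (q - 2))) / 4

theorem hasDerivAt_half_one_add (u : ℝ) : HasDerivAt (fun u : ℝ => (1 + u) / 2) (1 / 2) u :=
  ((hasDerivAt_id u).const_add 1).div_const 2

theorem hasDerivAt_half_one_sub (u : ℝ) : HasDerivAt (fun u : ℝ => (1 - u) / 2) (-1 / 2) u :=
  ((hasDerivAt_id u).const_sub 1).div_const 2

theorem hasDerivAt_binaryTsallis (q : ℝ) {u : ℝ} (h : u ∈ Set.Ioo (-1 : ℝ) 1) :
    HasDerivAt (binaryTsallis q) (binaryTsallisDeriv q u) u := by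
  have h1 : 0 < (1 + u) / 2 := by linarith [h.1]
  have h2 : 0 < (1 - u) / 2 := by linarith [h.2]
  have h3 := (hasDerivAt_tsallisSummand q h1).comp u (hasDerivAt_half_one_add u)
  have h4 := (hasDerivAt_tsallisSummand q h2).comp u (hasDerivAt_half_one_sub u)
  refine (h3.add h4).congr_deriv ?_
  simp only [binaryTsallisDeriv]
  ring

theorem hasDerivAt_binaryTsallisDeriv (q : ℝ) {u : ℝ} (h : u ∈ Set.Ioo (-1 : ℝ) 1) :
    HasDerivAt (binaryTsallisDeriv q) (binaryTsallisDeriv₂ q u) u := by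
  have h1 : 0 < (1 + u) / 2 := by linarith [h.1]
  have h2 : 0 < (1 - u) / 2 := by linarith [h.2]
  have h3 := (hasDerivAt_tsallisSummandDeriv q h1).comp u (hasDerivAt_half_one_add u)
  have h4 := (hasDerivAt_tsallisSummandDeriv q h2).comp u (hasDerivAt_half_one_sub u)
  refine ((h3.sub h4).div_const 2).congr_deriv ?_
  simp only [binaryTsallisDeriv₂]
  ring

theorem hasDerivAt_binaryTsallisDeriv₂ (q : ℝ) {u : ℝ} (h : u ∈ Set.Ioo (-1 : ℝ) 1) :
    HasDerivAt (binaryTsallisDeriv₂ q)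
      (-(q * ((q - 2) * (((1 + u) / 2) ^ (q - 3) - ((1 - u) / 2) ^ (q - 3)))) / 8) u := by
  have h1 : 0 < (1 + u) / 2 := by linarith [h.1]
  have h2 : 0 < (1 - u) / 2 := by linarith [h.2]
  have h3 := (Real.hasDerivAt_rpow_const (p := q - 2) (Or.inl h1.ne')).comp u
    (hasDerivAt_half_one_add u)
  have h4 := (Real.hasDerivAt_rpow_const (p := q - 2) (Or.inl h2.ne')).comp u
    (hasDerivAt_half_one_sub u)
  refine (((h3.add h4).const_mul q).neg.div_const 4).congr_deriv ?_
  rw [show q - 2 - 1 = q - 3 by ring]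
  ring

/-- The sign of the third derivative of `binaryTsallis q`. -/
theorem rpow_sub_rpow_sign {q u : ℝ} (hq : q ≤ 2 ∨ 3 ≤ q) (h0 : 0 ≤ u) (h1 : u < 1) :
    0 ≤ (q - 2) * (((1 + u) / 2) ^ (q - 3) - ((1 - u) / 2) ^ (q - 3)) := by
  have hle : (1 - u) / 2 ≤ (1 + u) / 2 := by linarith
  have hpos : 0 < (1 - u) / 2 := by linarith
  rcases hq with hq | hq
  · refine mul_nonneg_of_nonpos_of_nonpos (by linarith) (sub_nonpos.2 ?_)
    exact Real.rpow_le_rpow_of_nonpos hpos hle (by linarith)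
  · exact mul_nonneg (by linarith) (sub_nonneg.2 (Real.rpow_le_rpow hpos.le hle (by linarith)))

/-- With `B` the binary entropy, `u B'' - B'` vanishes at `0` and has derivative `u B'''`, which is
nonpositive on `[0, 1)` by `rpow_sub_rpow_sign`. -/
theorem mul_binaryTsallisDeriv₂_le {q u : ℝ} (hq0 : 0 < q) (hq : q ≤ 2 ∨ 3 ≤ q)
    (h0 : 0 ≤ u) (h1 : u < 1) : u * binaryTsallisDeriv₂ q u ≤ binaryTsallisDeriv q u := by
  have hD : ∀ x ∈ Set.Ico (0 : ℝ) 1, HasDerivAt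
      (fun u => u * binaryTsallisDeriv₂ q u - binaryTsallisDeriv q u)
      (x * (-(q * ((q - 2) * (((1 + x) / 2) ^ (q - 3) - ((1 - x) / 2) ^ (q - 3)))) / 8)) x := by
    intro x hx
    have hx' : x ∈ Set.Ioo (-1 : ℝ) 1 := ⟨by linarith [hx.1], hx.2⟩
    refine HasDerivAt.congr_deriv (((hasDerivAt_id x).mul (hasDerivAt_binaryTsallisDeriv₂ q hx')).sub
      (hasDerivAt_binaryTsallisDeriv q hx')) ?_
    simp
  have hanti : AntitoneOn (fun u => u * binaryTsallisDeriv₂ q u - binaryTsallisDeriv q u)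
      (Set.Ico 0 1) := by
    refine antitoneOn_of_deriv_nonpos (convex_Ico 0 1)
      (fun x hx => (hD x hx).continuousAt.continuousWithinAt)
      (fun x hx => (hD x (interior_subset hx)).differentiableAt.differentiableWithinAt) ?_
    intro x hx
    have hx := interior_subset hx
    rw [(hD x hx).deriv]
    have := mul_nonneg hq0.le (rpow_sub_rpow_sign hq hx.1 hx.2)
    exact mul_nonpos_of_nonneg_of_nonpos hx.1 (by linarith)
  have := hanti ⟨le_rfl, one_pos⟩ ⟨h0, h1⟩ h0
  simp only [binaryTsallisDeriv, add_zero, sub_zero, sub_self, zero_div, zero_mul] at this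
  simp only [binaryTsallisDeriv]
  linarith

theorem antitoneOn_binaryTsallisDeriv_div {q : ℝ} (hq0 : 0 < q) (hq : q ≤ 2 ∨ 3 ≤ q) :
    AntitoneOn (fun u => binaryTsallisDeriv q u / u) (Set.Ioo 0 1) := by
  have hD : ∀ x ∈ Set.Ioo (0 : ℝ) 1, HasDerivAt (fun u => binaryTsallisDeriv q u / u)
      ((binaryTsallisDeriv₂ q x * x - binaryTsallisDeriv q x * 1) / x ^ 2) x := by
    intro x hx
    have hx' : x ∈ Set.Ioo (-1 : ℝ) 1 := ⟨by linarith [hx.1], hx.2⟩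
    exact (hasDerivAt_binaryTsallisDeriv q hx').div (hasDerivAt_id x) hx.1.ne'
  refine antitoneOn_of_deriv_nonpos (convex_Ioo 0 1)
    (fun x hx => (hD x hx).continuousAt.continuousWithinAt)
    (fun x hx => (hD x (interior_subset hx)).differentiableAt.differentiableWithinAt) ?_
  intro x hx
  have hx := interior_subset hx
  rw [(hD x hx).deriv]
  have := mul_binaryTsallisDeriv₂_le hq0 hq hx.1.le hx.2
  exact div_nonpos_of_nonpos_of_nonneg (by linarith) (sq_nonneg x)

theorem continuous_binaryTsallis {q : ℝ} (hq0 : 0 < q) : Continuous (binaryTsallis q) := by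
  have := continuous_tsallisSummand hq0
  unfold binaryTsallis
  fun_prop

/-- By the chain rule the derivative at `y` is `B'(u) / (2u)` with `u = √y`, so monotonicity of
`B'(u)/u` is exactly what is needed. -/
theorem concaveOn_binaryTsallis_sqrt {q : ℝ} (hq0 : 0 < q) (hq : q ≤ 2 ∨ 3 ≤ q) :
    ConcaveOn ℝ (Set.Icc 0 1) (fun y => binaryTsallis q √y) := by
  have hD : ∀ y ∈ Set.Ioo (0 : ℝ) 1, HasDerivAt (fun y => binaryTsallis q √y)
      (binaryTsallisDeriv q √y * (1 / (2 * √y))) y := by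
    intro y hy
    have hs : √y ∈ Set.Ioo (-1 : ℝ) 1 :=
      ⟨by linarith [Real.sqrt_nonneg y], by rw [Real.sqrt_lt' one_pos]; simpa using hy.2⟩
    exact (hasDerivAt_binaryTsallis q hs).comp y (Real.hasDerivAt_sqrt hy.1.ne')
  refine AntitoneOn.concaveOn_of_deriv (convex_Icc 0 1)
    ((continuous_binaryTsallis hq0).comp Real.continuous_sqrt).continuousOn ?_ ?_
  · rw [interior_Icc]
    exact fun y hy => (hD y hy).differentiableAt.differentiableWithinAt
  · rw [interior_Icc]
    intro y hy z hz hyz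
    rw [(hD y hy).deriv, (hD z hz).deriv]
    have hm : ∀ y ∈ Set.Ioo (0 : ℝ) 1, √y ∈ Set.Ioo (0 : ℝ) 1 := fun y hy =>
      ⟨Real.sqrt_pos.2 hy.1, by rw [Real.sqrt_lt' one_pos]; simpa using hy.2⟩
    have := antitoneOn_binaryTsallisDeriv_div hq0 hq (hm y hy) (hm z hz) (Real.sqrt_le_sqrt hyz)
    have e : ∀ y : ℝ, binaryTsallisDeriv q √y * (1 / (2 * √y)) =
        binaryTsallisDeriv q √y / √y / 2 := fun y => by
      rw [div_div, mul_one_div, mul_comm 2]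
    rw [e, e]
    simp only at this
    linarith

/-! ### Concavity and subadditivity in the tangle. -/

/-- The Tsallis-`q` entanglement of a two-qubit pure state as a function of its tangle, the
squared concurrence. -/
noncomputable def tangleTsallis (q x : ℝ) : ℝ := binaryTsallis q √(1 - x)

theorem tangleTsallis_zero {q : ℝ} (hq0 : 0 < q) : tangleTsallis q 0 = 0 := by
  simp [tangleTsallis, binaryTsallis, tsallisSummand_zero hq0, tsallisSummand_one]

theorem tangleTsallis_nonneg {q x : ℝ} (hq0 : 0 < q) (h0 : 0 ≤ x) : 0 ≤ tangleTsallis q x := by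
  have h1 : √(1 - x) ≤ 1 := Real.sqrt_le_one.2 (by linarith)
  have h2 := Real.sqrt_nonneg (1 - x)
  exact add_nonneg (tsallisSummand_nonneg (by linarith) (by linarith) hq0)
    (tsallisSummand_nonneg (by linarith) (by linarith) hq0)

theorem exists_tangleTsallis_le {q : ℝ} (hq0 : 0 < q) :
    ∃ C, ∀ x ∈ Set.Icc (0 : ℝ) 1, tangleTsallis q x ≤ C := by
  have hc : Continuous (tangleTsallis q) :=
    (continuous_binaryTsallis hq0).comp (by fun_prop)
  obtain ⟨C, hC⟩ := isCompact_Icc.bddAbove_image hc.continuousOn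
  exact ⟨C, fun x hx => hC (Set.mem_image_of_mem _ hx)⟩

theorem mul_tangleTsallis_le {q x s : ℝ} (hq0 : 0 < q) (hq : q ≤ 2 ∨ 3 ≤ q)
    (hx : x ∈ Set.Icc (0 : ℝ) 1) (hs : s ∈ Set.Icc (0 : ℝ) 1) :
    s * tangleTsallis q x ≤ tangleTsallis q (s * x) := by
  -- The chord from tangle `0` (argument `1`) to tangle `x` (argument `1 - x`).
  have h := (concaveOn_binaryTsallis_sqrt hq0 hq).2 (show (1 : ℝ) ∈ Set.Icc 0 1 by simp)
    (show 1 - x ∈ Set.Icc (0 : ℝ) 1 from ⟨by linarith [hx.2], by linarith [hx.1]⟩)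
    (show 0 ≤ 1 - s by linarith [hs.2]) hs.1 (by ring)
  have h0 := tangleTsallis_zero hq0
  simp only [tangleTsallis, sub_zero, smul_eq_mul] at *
  rw [h0, show (1 - s) * 1 + s * (1 - x) = 1 - s * x by ring] at h
  linarith

/-- Scale `x + y` down by the fractions `x/(x+y)` and `y/(x+y)`, which sum to `1`. -/
theorem tangleTsallis_add_le {q x y : ℝ} (hq0 : 0 < q) (hq : q ≤ 2 ∨ 3 ≤ q)
    (hx : 0 ≤ x) (hy : 0 ≤ y) (hxy : x + y ≤ 1) :
    tangleTsallis q (x + y) ≤ tangleTsallis q x + tangleTsallis q y := by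
  rcases (add_nonneg hx hy).eq_or_lt with h | h
  · have hx : x = 0 := by linarith
    have hy : y = 0 := by linarith
    simp [hx, hy, tangleTsallis_zero hq0]
  have h1 := mul_tangleTsallis_le (s := x / (x + y)) hq0 hq ⟨h.le, hxy⟩
    ⟨by positivity, (div_le_one h).2 (by linarith)⟩
  have h2 := mul_tangleTsallis_le (s := y / (x + y)) hq0 hq ⟨h.le, hxy⟩
    ⟨by positivity, (div_le_one h).2 (by linarith)⟩
  rw [div_mul_cancel₀ _ h.ne'] at h1 h2
  have h3 : x / (x + y) + y / (x + y) = 1 := by rw [← add_div, div_self h.ne']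
  calc tangleTsallis q (x + y)
      = x / (x + y) * tangleTsallis q (x + y) + y / (x + y) * tangleTsallis q (x + y) := by
        rw [← add_mul, h3, one_mul]
    _ ≤ _ := add_le_add h1 h2

/-! ### The scalar inequality behind the weights. -/

theorem Kweight_nonneg {k μ : ℝ} (hk : 0 < k) (hμ : 0 < μ) : 0 ≤ Kweight k μ :=
  div_nonneg (sub_nonneg.2 (Real.one_le_rpow (by linarith) hμ.le)) (by positivity)

/-- The points `1` and `c(1 + k)` lie in the interval from `c` to `1 + ck` and have the same sum as
its endpoints. Concavity of the power thus gives `c^μ + (1 + ck)^μ ≤ 1 + (c(1 + k))^μ`. -/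
theorem one_add_mul_rpow_le {k μ c : ℝ} (hk : 0 < k) (hμ : 0 < μ) (hμ1 : μ ≤ 1)
    (hc : 0 ≤ c) (hc1 : c ≤ 1) : (1 + c * k) ^ μ ≤ 1 + c ^ μ * ((1 + k) ^ μ - 1) := by
  rcases hc.eq_or_lt with rfl | hc
  · simp [Real.zero_rpow hμ.ne']
  have hck : 0 < c * k := mul_pos hc hk
  -- `L` is the length of that interval; the barycentric weights of the two inner points are the
  -- same pair in opposite order.
  set L := 1 - c + c * k with hL
  have hLpos : 0 < L := by linarith
  have hcc := Real.concaveOn_rpow hμ.le hμ1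
  have hsum : c * k / L + (1 - c) / L = 1 := by
    rw [← add_div, div_eq_one_iff_eq hLpos.ne']; ring
  have ha : 0 ≤ c * k / L := by positivity
  have hb : 0 ≤ (1 - c) / L := div_nonneg (by linarith) hLpos.le
  have m1 : c ∈ Set.Ici (0 : ℝ) := hc.le
  have m2 : 1 + c * k ∈ Set.Ici (0 : ℝ) := by simp only [Set.mem_Ici]; linarith
  have h1 := hcc.2 m1 m2 ha hb hsum
  have h2 := hcc.2 m1 m2 hb ha (by linarith)
  have e1 : c * k / L * c + (1 - c) / L * (1 + c * k) = 1 := by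
    field_simp; rw [hL]; ring
  have e2 : (1 - c) / L * c + c * k / L * (1 + c * k) = c * (1 + k) := by
    field_simp; rw [hL]; ring
  simp only [smul_eq_mul] at h1 h2
  rw [e1, Real.one_rpow] at h1
  rw [e2, Real.mul_rpow hc.le (by linarith)] at h2
  have e3 : c * k / L = 1 - (1 - c) / L := by linarith
  rw [e3] at h1 h2
  linarith

/-- Homogeneous form of the previous bound, with `c = y / (k x)`; it is an equality at `y = k x`. -/
theorem add_rpow_le_add_Kweight {k μ x y : ℝ} (hk : 0 < k) (hμ : 0 < μ) (hμ1 : μ ≤ 1)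
    (hx : 0 ≤ x) (hy : 0 ≤ y) (hyx : y ≤ k * x) :
    (x + y) ^ μ ≤ x ^ μ + Kweight k μ * y ^ μ := by
  rcases hx.eq_or_lt with rfl | hx
  · have : y = 0 := le_antisymm (by simpa using hyx) hy
    simp [this, Real.zero_rpow hμ.ne']
  have hc : 0 ≤ y / (k * x) := by positivity
  have h := one_add_mul_rpow_le hk hμ hμ1 hc ((div_le_one (by positivity)).2 hyx)
  have e1 : x + y = x * (1 + y / (k * x) * k) := by field_simp
  have e2 : x ^ μ * (y / (k * x)) ^ μ = y ^ μ / k ^ μ := by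
    rw [← Real.mul_rpow hx.le hc, ← Real.div_rpow hy hk.le]
    congr 1; field_simp
  rw [e1, Real.mul_rpow hx.le (by positivity)]
  calc x ^ μ * (1 + y / (k * x) * k) ^ μ
      ≤ x ^ μ * (1 + (y / (k * x)) ^ μ * ((1 + k) ^ μ - 1)) := by gcongr
    _ = x ^ μ + x ^ μ * (y / (k * x)) ^ μ * ((1 + k) ^ μ - 1) := by ring
    _ = _ := by rw [e2, Kweight]; ring

/-! ### Entanglement of W-type pure vectors. -/

open Polynomial in
/-- If `A = B C` has rank at most two, a function vanishing at `0` has the same sum over the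
eigenvalues of `A` as over those of the `2 × 2` matrix `C B`. -/
theorem sum_eigenvalues_of_eq_mul {α : Type*} [Fintype α] [DecidableEq α] {A : Matrix α α ℂ}
    (hA : A.IsHermitian) (B : Matrix α (Fin 2) ℂ) (C : Matrix (Fin 2) α ℂ) (h : A = B * C)
    {l₁ l₂ : ℝ} (htr : (C * B).trace = ((l₁ + l₂ : ℝ) : ℂ))
    (hdet : (C * B).det = ((l₁ * l₂ : ℝ) : ℂ)) (g : ℝ → ℝ) (hg : g 0 = 0) :
    ∑ i, g (hA.eigenvalues i) = g l₁ + g l₂ := by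
  have hchar : (C * B).charpoly = (X - Polynomial.C (l₁ : ℂ)) * (X - Polynomial.C (l₂ : ℂ)) := by
    rw [Matrix.charpoly_fin_two, htr, hdet]
    push_cast
    simp only [map_add, map_mul]
    ring
  have hne : A.charpoly ≠ 0 := A.charpoly_monic.ne_zero
  have key := congrArg Polynomial.roots (Matrix.charpoly_mul_comm' B C)
  rw [← h, hchar, roots_mul (mul_ne_zero (pow_ne_zero _ X_ne_zero) hne), roots_mul, roots_mul,
    roots_X_sub_C, roots_X_sub_C, roots_X_pow, roots_X_pow, hA.roots_charpoly_eq_eigenvalues]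
    at key
  -- The root multisets agree up to extra zeros, which `g 0 = 0` makes invisible.
  · have := congrArg (fun s => (s.map (fun z : ℂ => g z.re)).sum) key
    simpa [Multiset.map_nsmul, Multiset.sum_nsmul, hg, Function.comp_def] using this
  · exact mul_ne_zero (X_sub_C_ne_zero _) (X_sub_C_ne_zero _)
  · exact mul_ne_zero (pow_ne_zero _ X_ne_zero)
      (mul_ne_zero (X_sub_C_ne_zero _) (X_sub_C_ne_zero _))

/-- The bipartite vector `|w⟩|0⟩ + |0⟩|v⟩ + y|0⟩|0⟩`. -/
def wVec {α β : Type*} [DecidableEq α] [Zero α] [DecidableEq β] [Zero β]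
    (w : α → ℂ) (v : β → ℂ) (y : ℂ) : α × β → ℂ := fun u =>
  (if u.2 = 0 then w u.1 else 0) + (if u.1 = 0 then v u.2 else 0) +
    if u.1 = 0 ∧ u.2 = 0 then y else 0

theorem wVec_eq_add {α β : Type*} [DecidableEq α] [Zero α] [DecidableEq β] [Zero β]
    (w : α → ℂ) (v : β → ℂ) (x y : ℂ) :
    wVec (x • w) (x • v) y = x • wVec w v 0 + y • wVec 0 0 1 := by
  ext u
  simp [wVec, mul_add]

/-- The squared Euclidean norm of a vector. -/
noncomputable def sumNormSq {α : Type*} [Fintype α] (w : α → ℂ) : ℝ := ∑ a, ‖w a‖ ^ 2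

theorem sumNormSq_nonneg {α : Type*} [Fintype α] (w : α → ℂ) : 0 ≤ sumNormSq w :=
  Finset.sum_nonneg fun _ _ => by positivity

theorem sumNormSq_smul {α : Type*} [Fintype α] (x : ℂ) (w : α → ℂ) :
    sumNormSq (x • w) = ‖x‖ ^ 2 * sumNormSq w := by
  simp [sumNormSq, Finset.mul_sum, mul_pow]

theorem star_dotProduct_self {α : Type*} [Fintype α] (w : α → ℂ) :
    star w ⬝ᵥ w = (sumNormSq w : ℂ) := by
  simp [sumNormSq, dotProduct, Complex.conj_mul']

theorem eq_zero_of_sumNormSq_eq_zero {α : Type*} [Fintype α] {w : α → ℂ}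
    (h : sumNormSq w = 0) : w = 0 := by
  ext a
  have := (Finset.sum_eq_zero_iff_of_nonneg fun i _ => by positivity).1 h a (Finset.mem_univ a)
  simpa using this

theorem star_wVec_dotProduct {α β : Type*} [Fintype α] [DecidableEq α] [Zero α]
    [Fintype β] [DecidableEq β] [Zero β] {w w' : α → ℂ} {v v' : β → ℂ} (y y' : ℂ)
    (hw : w 0 = 0) (hw' : w' 0 = 0) (hv : v 0 = 0) (hv' : v' 0 = 0) :
    star (wVec w v y) ⬝ᵥ wVec w' v' y' = star w ⬝ᵥ w' + star v ⬝ᵥ v' + star y * y' := by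
  have h : ∀ a b, star (wVec w v y (a, b)) * wVec w' v' y' (a, b) =
      (if b = 0 then star (w a) * w' a else 0) + (if a = 0 then star (v b) * v' b else 0) +
        if a = 0 then (if b = 0 then star y * y' else 0) else 0 := by
    intro a b
    by_cases ha : a = 0 <;> by_cases hb : b = 0 <;> simp [wVec, ha, hb, hw, hw', hv, hv']
  simp only [dotProduct, Fintype.sum_prod_type, Pi.star_apply, h, Finset.sum_add_distrib]
  congr 1
  · congr 1
    · simp
    · rw [Finset.sum_comm]
      simp
  · rw [Finset.sum_comm]
    simp

theorem sumNormSq_wVec {α β : Type*} [Fintype α] [DecidableEq α] [Zero α]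
    [Fintype β] [DecidableEq β] [Zero β] {w : α → ℂ} {v : β → ℂ} (y : ℂ)
    (hw : w 0 = 0) (hv : v 0 = 0) :
    sumNormSq (wVec w v y) = sumNormSq w + sumNormSq v + ‖y‖ ^ 2 := by
  have h := star_wVec_dotProduct y y hw hw hv hv
  simp only [star_dotProduct_self, Complex.star_def, Complex.conj_mul'] at h
  exact_mod_cast h

theorem tsallisEntropy_eq_sum {α : Type*} [Fintype α] [DecidableEq α] (q : ℝ)
    {ρ : Matrix α α ℂ} (hρ : ρ.IsHermitian) (htr : ∑ i, hρ.eigenvalues i = 1) :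
    tsallisEntropy q hρ = ∑ i, tsallisSummand q (hρ.eigenvalues i) := by
  unfold tsallisEntropy tsallisSummand
  split_ifs with h
  · rfl
  · rw [← Finset.sum_div, Finset.sum_sub_distrib, htr]

/-- The reduced matrix is `|w + y e₀⟩⟨w + y e₀| + ‖v‖² |e₀⟩⟨e₀|`; its range lies in the span of `w`
and `e₀`, the two columns of the left factor. -/
theorem reducedA_wVec_eq_mul {α β : Type*} [Fintype α] [DecidableEq α] [Zero α]
    [Fintype β] [DecidableEq β] [Zero β] {w : α → ℂ} {v : β → ℂ} (y : ℂ) (hv : v 0 = 0) :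
    reducedA (wVec w v y) =
      (Matrix.of fun a => ![w a, if a = 0 then 1 else 0] : Matrix α (Fin 2) ℂ) *
      (Matrix.of ![fun a => star (w a) + if a = 0 then star y else 0,
        fun a => y * star (w a) +
          if a = 0 then (sumNormSq v : ℂ) + y * star y else 0] : Matrix (Fin 2) α ℂ) := by
  ext a a'
  have h : ∀ b, wVec w v y (a, b) * star (wVec w v y (a', b)) =
      (if b = 0 then (w a + if a = 0 then y else 0) * (star (w a') + if a' = 0 then star y else 0)
        else 0) + (if a = 0 then if a' = 0 then 1 else 0 else 0) * (star (v b) * v b) := by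
    intro b
    by_cases ha : a = 0 <;> by_cases ha' : a' = 0 <;> by_cases hb : b = 0 <;>
      simp [wVec, ha, ha', hb, hv, mul_comm]
  have hs : ∑ b, star (v b) * v b = (sumNormSq v : ℂ) := star_dotProduct_self v
  simp only [reducedA, Matrix.of_apply, h, Finset.sum_add_distrib, ← Finset.mul_sum, hs,
    Matrix.mul_apply, Fin.sum_univ_two]
  by_cases ha : a = 0 <;> by_cases ha' : a' = 0 <;> simp [ha, ha'] <;> ring

/-- The reversed `2 × 2` product has trace `1` and determinant `‖w‖²‖v‖²`, the `‖y‖²` terms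
cancelling, so the spectrum is `(1 ± √(1 - 4‖w‖²‖v‖²)) / 2` up to zeros. -/
theorem tsallisPure_wVec {α β : Type*} [Fintype α] [DecidableEq α] [Zero α]
    [Fintype β] [DecidableEq β] [Zero β] {w : α → ℂ} {v : β → ℂ} {y : ℂ} {q : ℝ} (hq : 0 < q)
    (hw : w 0 = 0) (hv : v 0 = 0) (h1 : sumNormSq w + sumNormSq v + ‖y‖ ^ 2 = 1) :
    tsallisPure q (wVec w v y) = tangleTsallis q (4 * sumNormSq w * sumNormSq v) := by
  set x := 4 * sumNormSq w * sumNormSq v with hx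
  have hx1 : 0 ≤ 1 - x := by
    nlinarith [sq_nonneg (sumNormSq w - sumNormSq v), sumNormSq_nonneg w, sumNormSq_nonneg v,
      sq_nonneg ‖y‖]
  have hs := Real.sq_sqrt hx1
  set l₁ := (1 + √(1 - x)) / 2 with hl₁
  set l₂ := (1 - √(1 - x)) / 2 with hl₂
  have hadd : l₁ + l₂ = 1 := by rw [hl₁, hl₂]; ring
  have hmul : l₁ * l₂ = sumNormSq w * sumNormSq v := by
    rw [hl₁, hl₂]; linear_combination -hs / 4 - hx / 4
  have hww : ∑ a, star (w a) * w a = (sumNormSq w : ℂ) := star_dotProduct_self w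
  have key := sum_eigenvalues_of_eq_mul (l₁ := l₁) (l₂ := l₂)
    (reducedA_isHermitian (wVec w v y)) _ _ (reducedA_wVec_eq_mul (w := w) y hv) ?_ ?_
  · rw [tsallisPure, tsallisEntropy_eq_sum, key _ (tsallisSummand_zero hq)]
    · rfl
    · rw [key (fun t => t) rfl, hadd]
  all_goals
    set M := (Matrix.of ![fun a => star (w a) + if a = 0 then star y else 0,
        fun a => y * star (w a) +
          if a = 0 then (sumNormSq v : ℂ) + y * star y else 0] : Matrix (Fin 2) α ℂ) *
        (Matrix.of fun a => ![w a, if a = 0 then 1 else 0] : Matrix α (Fin 2) ℂ) with hM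
    have h00 : M 0 0 = (sumNormSq w : ℂ) := by
      simp only [hM, Matrix.mul_apply, Matrix.of_apply, Matrix.cons_val_zero, add_mul,
        Finset.sum_add_distrib, hww]
      simp [hw]
    have h01 : M 0 1 = star y := by
      simp only [hM, Matrix.mul_apply, Matrix.of_apply, Matrix.cons_val_zero,
        Matrix.cons_val_one]
      simp [hw]
    have h10 : M 1 0 = y * sumNormSq w := by
      simp only [hM, Matrix.mul_apply, Matrix.of_apply, Matrix.cons_val_zero,
        Matrix.cons_val_one, add_mul, Finset.sum_add_distrib, mul_assoc, ← Finset.mul_sum, hww]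
      simp [hw]
    have h11 : M 1 1 = (sumNormSq v : ℂ) + y * star y := by
      simp only [hM, Matrix.mul_apply, Matrix.of_apply, Matrix.cons_val_zero,
        Matrix.cons_val_one]
      simp [hw]
  · rw [Matrix.trace_fin_two, h00, h11, hadd, ← h1, Complex.star_def, Complex.mul_conj']
    push_cast; ring
  · rw [Matrix.det_fin_two, h00, h01, h10, h11, hmul]
    push_cast; ring

/-! ### Decompositions of W-type mixed states. -/

/-- The mixture of `|w⟩|0⟩ + |0⟩|v⟩ + b|0⟩|0⟩` with the vacuum of weight `c`. -/
noncomputable def wState {α β : Type*} [DecidableEq α] [Zero α] [DecidableEq β] [Zero β]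
    (w : α → ℂ) (v : β → ℂ) (b : ℂ) (c : ℝ) : Matrix (α × β) (α × β) ℂ :=
  Matrix.vecMulVec (wVec w v b) (star (wVec w v b)) +
    (c : ℂ) • Matrix.vecMulVec (wVec 0 0 1) (star (wVec (0 : α → ℂ) (0 : β → ℂ) 1))

theorem dotProduct_vecMulVec_mulVec {ι : Type*} [Fintype ι] (u r : ι → ℂ) :
    star r ⬝ᵥ (Matrix.vecMulVec u (star u)).mulVec r = ((‖star u ⬝ᵥ r‖ ^ 2 : ℝ) : ℂ) := by
  rw [Matrix.vecMulVec_mulVec, op_smul_eq_smul, dotProduct_smul, smul_eq_mul,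
    ← star_star (star r ⬝ᵥ u), ← Matrix.star_dotProduct_star, star_star, Complex.star_def,
    Complex.mul_conj']
  push_cast
  rfl

/-- Every member of a pure state decomposition is orthogonal to the kernel. -/
theorem IsPureDecomposition.star_dotProduct_eq_zero {α β : Type*} [Fintype α] [Fintype β]
    {ρ : Matrix (α × β) (α × β) ℂ} {m : ℕ} {p : Fin m → ℝ} {χ : Fin m → α × β → ℂ}
    (h : IsPureDecomposition ρ p χ) {r : α × β → ℂ} (hr : ρ.mulVec r = 0) {i : Fin m}
    (hi : p i ≠ 0) : star (χ i) ⬝ᵥ r = 0 := by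
  obtain ⟨hp, -, -, hρ⟩ := h
  have h0 : star r ⬝ᵥ ρ.mulVec r = 0 := by rw [hr, dotProduct_zero]
  rw [hρ, Matrix.sum_mulVec, dotProduct_sum] at h0
  simp only [Matrix.smul_mulVec, dotProduct_smul, dotProduct_vecMulVec_mulVec, smul_eq_mul] at h0
  have h1 : ∑ j, p j * ‖star (χ j) ⬝ᵥ r‖ ^ 2 = 0 := by exact_mod_cast h0
  have h2 := (Finset.sum_eq_zero_iff_of_nonneg fun j _ =>
    mul_nonneg (hp j) (sq_nonneg ‖star (χ j) ⬝ᵥ r‖)).1 h1 i (Finset.mem_univ i)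
  simpa [hi] using h2

/-- The pure states in a decomposition of `wState w v b c` are again of `W` type. -/
theorem IsPureDecomposition.exists_wVec {α β : Type*} [Fintype α] [DecidableEq α] [Zero α]
    [Fintype β] [DecidableEq β] [Zero β] {w : α → ℂ} {v : β → ℂ} {b : ℂ} {c : ℝ}
    (hw : w 0 = 0) (hv : v 0 = 0) {m : ℕ} {p : Fin m → ℝ} {χ : Fin m → α × β → ℂ}
    (h : IsPureDecomposition (wState w v b c) p χ) (i : Fin m) :
    ∃ x y : ℂ, ‖x‖ ^ 2 * (sumNormSq w + sumNormSq v) + ‖y‖ ^ 2 = 1 ∧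
      (p i ≠ 0 → χ i = wVec (x • w) (x • v) y) := by
  by_cases hi : p i = 0
  · exact ⟨0, 1, by simp, fun h => absurd hi h⟩
  have z1 : (0 : α → ℂ) 0 = 0 := rfl
  have z2 : (0 : β → ℂ) 0 = 0 := rfl
  set ω := wVec w v 0 with hω
  set e : α × β → ℂ := wVec 0 0 1 with he
  have hee : star e ⬝ᵥ e = 1 := by
    rw [he, star_wVec_dotProduct _ _ z1 z1 z2 z2]; simp
  have hωe : star ω ⬝ᵥ e = 0 := by
    rw [he, hω, star_wVec_dotProduct _ _ hw z1 hv z2]; simp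
  have heω : star e ⬝ᵥ ω = 0 := by
    rw [he, hω, star_wVec_dotProduct _ _ z1 hw z2 hv]; simp
  have hb : wVec w v b = ω + b • e := by
    simpa using wVec_eq_add w v 1 b
  set x : ℂ := star ω ⬝ᵥ χ i / (sumNormSq ω : ℂ) with hx
  set y : ℂ := star e ⬝ᵥ χ i with hy
  -- The residual of the projection onto the span of `ω` and `e`. It lies in the kernel of the
  -- state, so `χ i` is orthogonal to it, and then `r` is orthogonal to itself. If `ω = 0`, division
  -- by zero makes `x = 0`.
  set r := χ i - (x • ω + y • e) with hr
  have hωr : star ω ⬝ᵥ r = 0 := by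
    rw [hr, dotProduct_sub, dotProduct_add, dotProduct_smul, dotProduct_smul, hωe,
      star_dotProduct_self, hx]
    by_cases h0 : sumNormSq ω = 0
    · simp [eq_zero_of_sumNormSq_eq_zero h0]
    · have : (sumNormSq ω : ℂ) ≠ 0 := by exact_mod_cast h0
      simp [div_mul_cancel₀ _ this]
  have her : star e ⬝ᵥ r = 0 := by
    rw [hr, dotProduct_sub, dotProduct_add, dotProduct_smul, dotProduct_smul, heω, hee, hy]
    simp
  have hρr : (wState w v b c).mulVec r = 0 := by
    rw [wState, hb, Matrix.add_mulVec, Matrix.smul_mulVec, Matrix.vecMulVec_mulVec,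
      Matrix.vecMulVec_mulVec, her, star_add, star_smul, add_dotProduct, smul_dotProduct, hωr, her]
    simp
  have hχr := h.star_dotProduct_eq_zero hρr hi
  have hrr : star r ⬝ᵥ r = 0 := by
    conv_lhs => rw [hr, star_sub, star_add, star_smul, star_smul, sub_dotProduct, add_dotProduct,
      smul_dotProduct, smul_dotProduct, ← hr, hωr, her, hχr]
    simp
  have hr0 : r = 0 := by
    rw [star_dotProduct_self] at hrr
    exact eq_zero_of_sumNormSq_eq_zero (by exact_mod_cast hrr)
  have hχ : χ i = wVec (x • w) (x • v) y := by
    rw [wVec_eq_add]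
    exact sub_eq_zero.1 hr0
  refine ⟨x, y, ?_, fun _ => hχ⟩
  have hn := h.2.2.1 i
  rw [hχ] at hn
  have := sumNormSq_wVec y (show (x • w) 0 = 0 by simp [hw]) (show (x • v) 0 = 0 by simp [hv])
  rw [sumNormSq_smul, sumNormSq_smul, sumNormSq, hn] at this
  linarith

theorem four_mul_sumNormSq_mem_Icc {α β : Type*} [Fintype α] [Fintype β] {w : α → ℂ}
    {v : β → ℂ} {y : ℂ} (h : sumNormSq w + sumNormSq v + ‖y‖ ^ 2 = 1) :
    4 * sumNormSq w * sumNormSq v ∈ Set.Icc (0 : ℝ) 1 := by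
  have h1 := sumNormSq_nonneg w
  have h2 := sumNormSq_nonneg v
  refine ⟨by positivity, ?_⟩
  nlinarith [sq_nonneg (sumNormSq w - sumNormSq v), sq_nonneg ‖y‖]

/-- The average entanglement of a decomposition, in terms of the `W`-type parametrization. -/
theorem IsPureDecomposition.sum_tsallisPure {α β : Type*} [Fintype α] [DecidableEq α] [Zero α]
    [Fintype β] [DecidableEq β] [Zero β] {w : α → ℂ} {v : β → ℂ} {b : ℂ} {c q : ℝ}
    (hq : 0 < q) (hw : w 0 = 0) (hv : v 0 = 0) {m : ℕ} {p : Fin m → ℝ} {χ : Fin m → α × β → ℂ}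
    (h : IsPureDecomposition (wState w v b c) p χ) :
    ∃ x y : Fin m → ℂ,
      (∀ i, ‖x i‖ ^ 2 * (sumNormSq w + sumNormSq v) + ‖y i‖ ^ 2 = 1) ∧
      (∀ i, p i ≠ 0 → χ i = wVec (x i • w) (x i • v) (y i)) ∧
      ∑ i, p i * tsallisPure q (χ i) =
        ∑ i, p i * tangleTsallis q (4 * sumNormSq (x i • w) * sumNormSq (x i • v)) := by
  choose x y hxy hχ using h.exists_wVec hw hv
  refine ⟨x, y, hxy, hχ, Finset.sum_congr rfl fun i _ => ?_⟩
  by_cases hi : p i = 0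
  · simp [hi]
  rw [hχ i hi, tsallisPure_wVec hq (by simp [hw]) (by simp [hv])]
  rw [sumNormSq_smul, sumNormSq_smul, ← hxy i]
  ring

/-- Needed for the supremum defining `tsallisAssist` to dominate each of its members. -/
theorem bddAbove_average_tsallisPure {α β : Type*} [Fintype α] [DecidableEq α] [Zero α]
    [Fintype β] [DecidableEq β] [Zero β] {w : α → ℂ} {v : β → ℂ} {q : ℝ} (b : ℂ) (c : ℝ)
    (hq : 0 < q) (hw : w 0 = 0) (hv : v 0 = 0) :
    BddAbove {a : ℝ | ∃ (m : ℕ) (p : Fin m → ℝ) (φ : Fin m → α × β → ℂ),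
      IsPureDecomposition (wState w v b c) p φ ∧ a = ∑ i, p i * tsallisPure q (φ i)} := by
  obtain ⟨C, hC⟩ := exists_tangleTsallis_le hq
  refine ⟨C, ?_⟩
  rintro _ ⟨m, p, χ, h, rfl⟩
  obtain ⟨x, y, hxy, -, hs⟩ := h.sum_tsallisPure hq hw hv
  rw [hs]
  calc _ ≤ ∑ i, p i * C := Finset.sum_le_sum fun i _ =>
        mul_le_mul_of_nonneg_left (hC _ (four_mul_sumNormSq_mem_Icc (y := y i) (by
          rw [sumNormSq_smul, sumNormSq_smul, ← hxy i]; ring))) (h.1 i)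
    _ = C := by rw [← Finset.sum_mul, h.2.1, one_mul]

theorem tsallisAssist_wState_nonneg {α β : Type*} [Fintype α] [DecidableEq α] [Zero α]
    [Fintype β] [DecidableEq β] [Zero β] {w : α → ℂ} {v : β → ℂ} {q : ℝ} (b : ℂ) (c : ℝ)
    (hq : 0 < q) (hw : w 0 = 0) (hv : v 0 = 0) : 0 ≤ tsallisAssist q (wState w v b c) := by
  refine Real.sSup_nonneg ?_
  rintro _ ⟨m, p, χ, h, rfl⟩
  obtain ⟨x, y, -, -, hs⟩ := h.sum_tsallisPure hq hw hv
  rw [hs]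
  refine Finset.sum_nonneg fun i _ => mul_nonneg (h.1 i) (tangleTsallis_nonneg hq ?_)
  have h1 := sumNormSq_nonneg (x i • w)
  have h2 := sumNormSq_nonneg (x i • v)
  positivity

/-- A decomposition over an arbitrary finite index type bounds `tsallisAssist` from below. -/
theorem sum_le_tsallisAssist_wState {α β : Type*} [Fintype α] [DecidableEq α] [Zero α]
    [Fintype β] [DecidableEq β] [Zero β] {w : α → ℂ} {v : β → ℂ} {b : ℂ} {c q : ℝ}
    (hq : 0 < q) (hw : w 0 = 0) (hv : v 0 = 0) {ι : Type*} [Fintype ι] {p : ι → ℝ}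
    {χ : ι → α × β → ℂ} (hp : ∀ i, 0 ≤ p i) (hp1 : ∑ i, p i = 1) (hχ : ∀ i, sumNormSq (χ i) = 1)
    (hρ : wState w v b c = ∑ i, (p i : ℂ) • Matrix.vecMulVec (χ i) (star (χ i))) :
    ∑ i, p i * tsallisPure q (χ i) ≤ tsallisAssist q (wState w v b c) := by
  let f := (Fintype.equivFin ι).symm
  refine le_csSup (bddAbove_average_tsallisPure b c hq hw hv)
    ⟨Fintype.card ι, fun i => p (f i), fun i => χ (f i),
      ⟨fun i => hp _, ?_, fun i => hχ _, ?_⟩, ?_⟩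
  · rw [← hp1, Equiv.sum_comp f p]
  · rw [hρ, ← Equiv.sum_comp f]
  · rw [← Equiv.sum_comp f]

/-! ### Passing to smaller blocks, and polygamy. -/

/-- Adding or subtracting a vector of squared length `t` at a right angle to `y`. -/
theorem exists_norm_add_sq_eq (y : ℂ) {t : ℝ} (ht : 0 ≤ t) :
    ∃ z : ℂ, ‖z‖ ^ 2 = t ∧ ‖y + z‖ ^ 2 = ‖y‖ ^ 2 + t ∧ ‖y + -z‖ ^ 2 = ‖y‖ ^ 2 + t := by
  suffices h : ∃ z : ℂ, ‖z‖ ^ 2 = t ∧ y.re * z.re + y.im * z.im = 0 by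
    obtain ⟨z, hz, ho⟩ := h
    refine ⟨z, hz, ?_, ?_⟩ <;> rw [← hz] <;>
      simp only [Complex.sq_norm, Complex.normSq_apply, Complex.add_re, Complex.add_im,
        Complex.neg_re, Complex.neg_im]
    · linear_combination 2 * ho
    · linear_combination -2 * ho
  by_cases hy : y = 0
  · exact ⟨(√t : ℝ), by simp [Real.sq_sqrt ht], by simp [hy]⟩
  · have hy' : ‖y‖ ≠ 0 := norm_ne_zero_iff.2 hy
    -- A quarter turn of `y`, rescaled to length `√t`.
    refine ⟨((√t / ‖y‖ : ℝ) : ℂ) * (Complex.I * y), ?_, ?_⟩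
    · rw [norm_mul, norm_mul, Complex.norm_I, Complex.norm_real, one_mul, Real.norm_eq_abs,
        mul_pow, sq_abs, div_pow, Real.sq_sqrt ht, div_mul_cancel₀ _ (pow_ne_zero _ hy')]
    · simp only [Complex.re_ofReal_mul, Complex.im_ofReal_mul, Complex.I_mul_re, Complex.I_mul_im]
      ring

/-- The second moments of the coefficients of a decomposition of `wState w v b c`. -/
theorem IsPureDecomposition.moments {α β : Type*} [Fintype α] [DecidableEq α] [Zero α]
    [Fintype β] [DecidableEq β] [Zero β] {w : α → ℂ} {v : β → ℂ} {b : ℂ} {c : ℝ}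
    (hw : w 0 = 0) (hv : v 0 = 0) (hw0 : w ≠ 0) {m : ℕ} {p : Fin m → ℝ}
    {χ : Fin m → α × β → ℂ} (h : IsPureDecomposition (wState w v b c) p χ) {x y : Fin m → ℂ}
    (hχ : ∀ i, p i ≠ 0 → χ i = wVec (x i • w) (x i • v) (y i)) :
    ∑ i, (p i : ℂ) * (x i * star (x i)) = 1 ∧ ∑ i, (p i : ℂ) * (x i * star (y i)) = star b ∧
      ∑ i, (p i : ℂ) * (y i * star (x i)) = b ∧
      ∑ i, (p i : ℂ) * (y i * star (y i)) = b * star b + c := by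
  obtain ⟨a, ha⟩ : ∃ a, w a ≠ 0 := by
    by_contra hcon
    exact hw0 (funext fun a => not_not.1 fun h => hcon ⟨a, h⟩)
  have ha0 : a ≠ 0 := fun h => ha (h ▸ hw)
  have key : ∀ u u', wState w v b c u u' = ∑ i, (p i : ℂ) *
      (wVec (x i • w) (x i • v) (y i) u * star (wVec (x i • w) (x i • v) (y i) u')) := by
    intro u u'
    rw [h.2.2.2, Matrix.sum_apply]
    refine Finset.sum_congr rfl fun i _ => ?_
    by_cases hi : p i = 0
    · simp [hi]
    · rw [hχ i hi]
      simp [Matrix.vecMulVec_apply]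
  have e1 : ∀ x y : ℂ, wVec (x • w) (x • v) y (a, 0) = x * w a := by
    intro x y; simp [wVec, ha0]
  have e2 : ∀ x y : ℂ, wVec (x • w) (x • v) y (0, 0) = y := by
    intro x y; simp [wVec, hw, hv]
  have e3 : wVec w v b (a, 0) = w a := by simpa using e1 1 b
  have e4 : wVec w v b (0, 0) = b := by simpa using e2 1 b
  have e5 : wVec (0 : α → ℂ) (0 : β → ℂ) 1 (a, 0) = 0 := by simp [wVec, ha0]
  have e6 : wVec (0 : α → ℂ) (0 : β → ℂ) 1 (0, 0) = 1 := by simp [wVec]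
  have ha' : star (w a) ≠ 0 := by simpa using ha
  -- Matrix entries at `(a, 0)` and `(0, 0)` isolate the moments, since `w a ≠ 0` can be cancelled.
  refine ⟨?_, ?_, ?_, ?_⟩
  · have := key (a, 0) (a, 0)
    simp only [wState, Matrix.add_apply, Matrix.smul_apply, Matrix.vecMulVec_apply, Pi.star_apply,
      e1, e3, e5, zero_mul, smul_zero, add_zero] at this
    apply mul_right_cancel₀ (mul_ne_zero ha ha')
    rw [one_mul]
    refine Eq.trans ?_ this.symm
    rw [Finset.sum_mul]
    refine Finset.sum_congr rfl fun i _ => ?_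
    rw [star_mul']
    ring
  · have := key (a, 0) (0, 0)
    simp only [wState, Matrix.add_apply, Matrix.smul_apply, Matrix.vecMulVec_apply, Pi.star_apply,
      e1, e2, e3, e4, e5, zero_mul, smul_zero, add_zero] at this
    apply mul_left_cancel₀ ha
    rw [this, Finset.mul_sum]
    refine Finset.sum_congr rfl fun i _ => ?_
    ring
  · have := key (0, 0) (a, 0)
    simp only [wState, Matrix.add_apply, Matrix.smul_apply, Matrix.vecMulVec_apply, Pi.star_apply,
      e1, e2, e3, e4, e5, star_zero, mul_zero, smul_zero, add_zero] at this
    apply mul_right_cancel₀ ha'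
    rw [this, Finset.sum_mul]
    refine Finset.sum_congr rfl fun i _ => ?_
    rw [star_mul']
    ring
  · have := key (0, 0) (0, 0)
    simp only [wState, Matrix.add_apply, Matrix.smul_apply, Matrix.vecMulVec_apply, Pi.star_apply,
      e2, e4, e6, star_one, mul_one, smul_eq_mul] at this
    exact this.symm

/-- A decomposition for the cut `P|QR` induces one for `P|Q`, with all the members that come from
the same original member having equal concurrence. -/
theorem sum_tangleTsallis_le_tsallisAssist {α β : Type*} [Fintype α] [DecidableEq α] [Zero α]
    [Fintype β] [DecidableEq β] [Zero β] {w : α → ℂ} {v : β → ℂ} {b : ℂ} {c q s : ℝ}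
    (hq : 0 < q) (hw : w 0 = 0) (hv : v 0 = 0) (hs : 0 ≤ s) {m : ℕ} {p : Fin m → ℝ}
    (hp : ∀ i, 0 ≤ p i) (hp1 : ∑ i, p i = 1) {x y : Fin m → ℂ}
    (hxy : ∀ i, ‖x i‖ ^ 2 * (sumNormSq w + (sumNormSq v + s)) + ‖y i‖ ^ 2 = 1)
    (m1 : ∑ i, (p i : ℂ) * (x i * star (x i)) = 1)
    (m2 : ∑ i, (p i : ℂ) * (x i * star (y i)) = star b)
    (m3 : ∑ i, (p i : ℂ) * (y i * star (x i)) = b)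
    (m4 : ∑ i, (p i : ℂ) * (y i * star (y i)) = b * star b + c) :
    ∑ i, p i * tangleTsallis q (4 * sumNormSq (x i • w) * sumNormSq (x i • v)) ≤
      tsallisAssist q (wState w v b (c + s)) := by
  choose z hz hadd hsub using fun i =>
    exists_norm_add_sq_eq (y i) (show 0 ≤ ‖x i‖ ^ 2 * s by positivity)
  have hxw : ∀ i, (x i • w) 0 = 0 := fun i => by simp [hw]
  have hxv : ∀ i, (x i • v) 0 = 0 := fun i => by simp [hv]
  -- Each member is split into two of half weight with vacuum coefficients `y ± z`. Orthogonality of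
  -- `z` to `y` makes both unit vectors, the terms linear in `z` cancel, and `‖z‖² = ‖x‖² s`
  -- averages to the added vacuum weight `s`.
  let Y : Fin m × Bool → ℂ := fun j => y j.1 + if j.2 then z j.1 else -z j.1
  have hY : ∀ j, ‖Y j‖ ^ 2 = ‖y j.1‖ ^ 2 + ‖x j.1‖ ^ 2 * s := by
    rintro ⟨i, _ | _⟩
    · simpa [Y] using hsub i
    · simpa [Y] using hadd i
  have hnorm : ∀ j : Fin m × Bool,
      sumNormSq (x j.1 • w) + sumNormSq (x j.1 • v) + ‖Y j‖ ^ 2 = 1 := by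
    intro j
    rw [hY, sumNormSq_smul, sumNormSq_smul, ← hxy j.1]
    ring
  have key := sum_le_tsallisAssist_wState (b := b) (c := c + s) hq hw hv
    (ι := Fin m × Bool) (p := fun j => p j.1 / 2)
    (χ := fun j => wVec (x j.1 • w) (x j.1 • v) (Y j)) (fun j => div_nonneg (hp j.1) two_pos.le) ?_ ?_ ?_
  · refine le_trans (le_of_eq ?_) key
    rw [Fintype.sum_prod_type]
    refine Finset.sum_congr rfl fun i _ => ?_
    rw [Fintype.sum_bool, tsallisPure_wVec hq (hxw i) (hxv i) (hnorm (i, true)),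
      tsallisPure_wVec hq (hxw i) (hxv i) (hnorm (i, false))]
    ring
  · simp [Fintype.sum_prod_type, mul_div_cancel₀, hp1]
  · intro j
    rw [sumNormSq_wVec _ (hxw _) (hxv _), hnorm]
  · have mz : ∑ i, (p i : ℂ) * (z i * star (z i)) = s := by
      have : ∀ i, (p i : ℂ) * (z i * star (z i)) = (p i : ℂ) * (x i * star (x i)) * s := by
        intro i
        rw [Complex.star_def, Complex.mul_conj', Complex.mul_conj', mul_assoc]
        congr 1
        exact_mod_cast hz i
      simp only [this]
      rw [← Finset.sum_mul, m1, one_mul]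
    ext u u'
    have hb : wVec w v b = wVec w v 0 + b • wVec 0 0 1 := by simpa using wVec_eq_add w v 1 b
    rw [wState, hb, Matrix.sum_apply, Fintype.sum_prod_type]
    simp only [Fintype.sum_bool, wVec_eq_add, Y, Matrix.smul_apply, Matrix.vecMulVec_apply,
      Matrix.add_apply, Pi.add_apply, Pi.star_apply, Pi.smul_apply, smul_eq_mul, if_true,
      Bool.false_eq_true, if_false, star_add, star_mul', star_neg]
    generalize wVec w v 0 u = A
    generalize star (wVec w v 0 u') = A'
    generalize wVec (0 : α → ℂ) (0 : β → ℂ) 1 u = E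
    generalize star (wVec (0 : α → ℂ) (0 : β → ℂ) 1 u') = E'
    calc _ = 1 * (A * A') + star b * (A * E') + b * (E * A') + (b * star b + c) * (E * E') +
          s * (E * E') := by push_cast; ring
      _ = _ := by
        rw [← m4, ← m2, ← mz, ← m1, ← m3]
        simp only [Finset.sum_mul, ← Finset.sum_add_distrib]
        refine Finset.sum_congr rfl fun i _ => ?_
        push_cast
        ring

/-- Polygamy of the entanglement of assistance for `W`-type states. -/
theorem tsallisAssist_wState_le_add {α β β₁ β₂ : Type*} [Fintype α] [DecidableEq α] [Zero α]
    [Fintype β] [DecidableEq β] [Zero β] [Fintype β₁] [DecidableEq β₁] [Zero β₁]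
    [Fintype β₂] [DecidableEq β₂] [Zero β₂] {w : α → ℂ} {v : β → ℂ} {v₁ : β₁ → ℂ}
    {v₂ : β₂ → ℂ} {q : ℝ} (b : ℂ) (c : ℝ) (hq0 : 0 < q) (hq : q ≤ 2 ∨ 3 ≤ q) (hw : w 0 = 0)
    (hv : v 0 = 0) (hv₁ : v₁ 0 = 0) (hv₂ : v₂ 0 = 0)
    (hsum : sumNormSq v = sumNormSq v₁ + sumNormSq v₂) :
    tsallisAssist q (wState w v b c) ≤
      tsallisAssist q (wState w v₁ b (c + sumNormSq v₂)) +
        tsallisAssist q (wState w v₂ b (c + sumNormSq v₁)) := by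
  have hnn := add_nonneg (tsallisAssist_wState_nonneg b (c + sumNormSq v₂) hq0 hw hv₁)
    (tsallisAssist_wState_nonneg b (c + sumNormSq v₁) hq0 hw hv₂)
  refine Real.sSup_le ?_ hnn
  rintro _ ⟨m, p, χ, h, rfl⟩
  obtain ⟨x, y, hxy, hχ, hs⟩ := h.sum_tsallisPure hq0 hw hv
  rw [hs]
  -- With `w = 0` every tangle vanishes, while the moments would not be determined.
  by_cases hw0 : w = 0
  · refine le_trans (le_of_eq (Finset.sum_eq_zero fun i _ => ?_)) hnn
    simp [hw0, sumNormSq, tangleTsallis_zero hq0]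
  obtain ⟨m1, m2, m3, m4⟩ := h.moments hw hv hw0 hχ
  refine le_trans ?_ (add_le_add
    (sum_tangleTsallis_le_tsallisAssist (v := v₁) (x := x) (y := y) hq0 hw hv₁
      (sumNormSq_nonneg v₂) h.1 h.2.1 (by rwa [← hsum]) m1 m2 m3 m4)
    (sum_tangleTsallis_le_tsallisAssist (v := v₂) (x := x) (y := y) hq0 hw hv₂
      (sumNormSq_nonneg v₁) h.1 h.2.1 (by rwa [add_comm (sumNormSq v₂), ← hsum]) m1 m2 m3 m4))
  rw [← Finset.sum_add_distrib]
  refine Finset.sum_le_sum fun i _ => ?_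
  rw [← mul_add]
  refine mul_le_mul_of_nonneg_left ?_ (h.1 i)
  have h1 := (four_mul_sumNormSq_mem_Icc (w := x i • w) (v := x i • v) (y := y i)
    (by rw [sumNormSq_smul, sumNormSq_smul, ← hxy i]; ring)).2
  have e : 4 * sumNormSq (x i • w) * sumNormSq (x i • v) =
      4 * sumNormSq (x i • w) * sumNormSq (x i • v₁) +
        4 * sumNormSq (x i • w) * sumNormSq (x i • v₂) := by
    simp only [sumNormSq_smul, hsum]
    ring
  rw [e] at h1 ⊢
  have n1 := sumNormSq_nonneg (x i • w)
  have n2 := sumNormSq_nonneg (x i • v₁)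
  have n3 := sumNormSq_nonneg (x i • v₂)
  exact tangleTsallis_add_le hq0 hq (by positivity) (by positivity) h1

/-! ### Reduced states of GWV states. -/

/-- The generalized `W`-class vector with amplitudes `a` over an arbitrary set of parties. -/
def wConfig {ι : Type*} [Fintype ι] [DecidableEq ι] {d : ℕ} [NeZero d] (a : ι → Fin d → ℂ) :
    (ι → Fin d) → ℂ := fun x =>
  ∑ s, ∑ i ∈ Finset.univ.filter (fun i : Fin d => i ≠ 0), if x = Pi.single s i then a s i else 0

theorem wConfig_zero {ι : Type*} [Fintype ι] [DecidableEq ι] {d : ℕ} [NeZero d]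
    (a : ι → Fin d → ℂ) : wConfig a 0 = 0 := by
  refine Finset.sum_eq_zero fun s _ => Finset.sum_eq_zero fun i hi => if_neg fun h => ?_
  have := congrFun h s
  rw [Pi.single_eq_same] at this
  exact (Finset.mem_filter.1 hi).2 this.symm

theorem sumNormSq_sum_ite {κ X : Type*} [Fintype κ] [Fintype X] [DecidableEq X] {f : κ → X}
    (hf : Function.Injective f) (g : κ → ℂ) :
    sumNormSq (fun x => ∑ k, if x = f k then g k else 0) = ∑ k, ‖g k‖ ^ 2 := by
  refine (Fintype.sum_of_injective f hf _ _ (fun x hx => ?_) fun k => ?_).symm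
  · have : ∀ k, x ≠ f k := fun k h => hx ⟨k, h.symm⟩
    simp [this]
  · have : (∑ j, if f k = f j then g j else 0) = g k :=
      (Finset.sum_eq_single k (fun j _ hj => if_neg fun h => hj (hf h).symm)
        (fun h => absurd (Finset.mem_univ k) h)).trans (if_pos rfl)
    simp only [this]

/-- The weight of party `s` in the `W`-class vector with amplitudes `a`. -/
noncomputable def partyWeight {ι : Type*} {d : ℕ} [NeZero d] (a : ι → Fin d → ℂ) (s : ι) : ℝ :=
  ∑ i ∈ Finset.univ.filter (fun i : Fin d => i ≠ 0), ‖a s i‖ ^ 2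

theorem sumNormSq_wConfig {ι : Type*} [Fintype ι] [DecidableEq ι] {d : ℕ} [NeZero d]
    (a : ι → Fin d → ℂ) : sumNormSq (wConfig a) = ∑ s, partyWeight a s := by
  have hsub : ∀ {M : Type} [AddCommMonoid M] (F : Fin d → M),
      ∑ i ∈ Finset.univ.filter (fun i : Fin d => i ≠ 0), F i = ∑ i : {i : Fin d // i ≠ 0}, F i :=
    fun F => Finset.sum_subtype _ (by simp) F
  -- Restricting to nonzero levels matters: `Pi.single s 0` is the vacuum for every `s`.
  have hinj : Function.Injective
      (fun k : ι × {i : Fin d // i ≠ 0} => (Pi.single k.1 k.2.1 : ι → Fin d)) := by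
    rintro ⟨s, i, hi⟩ ⟨s', i', hi'⟩ h
    have h1 : i = (Pi.single s' i' : ι → Fin d) s := by
      simpa using congrFun h s
    have hs : s = s' := by
      by_contra hs
      rw [Pi.single_eq_of_ne hs] at h1
      exact hi h1
    subst hs
    rw [Pi.single_eq_same] at h1
    simp [h1]
  have h1 : wConfig a = fun x => ∑ k : ι × {i : Fin d // i ≠ 0},
      if x = (Pi.single k.1 k.2.1 : ι → Fin d) then a k.1 k.2.1 else 0 := by
    ext x
    simp only [wConfig, hsub, Fintype.sum_prod_type]
  rw [h1, sumNormSq_sum_ite hinj, Fintype.sum_prod_type]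
  simp only [partyWeight, hsub]

theorem assemble_inj {n d : ℕ} {P Q : Finset (Fin n)} (h : Disjoint P Q) {x x' : P → Fin d}
    {y y' : Q → Fin d} {z z' : {s : Fin n // s ∉ P ∪ Q} → Fin d} :
    assemble P Q x y z = assemble P Q x' y' z' ↔ x = x' ∧ y = y' ∧ z = z' := by
  refine ⟨fun e => ⟨?_, ?_, ?_⟩, by rintro ⟨rfl, rfl, rfl⟩; rfl⟩
  · ext ⟨s, hs⟩ : 1
    simpa [assemble, hs] using congrFun e s
  · ext ⟨s, hs⟩ : 1
    simpa [assemble, hs, Finset.disjoint_right.1 h hs] using congrFun e s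
  · ext ⟨s, hs⟩ : 1
    have h1 : s ∉ P := fun h => hs (Finset.mem_union_left _ h)
    have h2 : s ∉ Q := fun h => hs (Finset.mem_union_right _ h)
    simpa [assemble, h1, h2] using congrFun e s

theorem assemble_zero {n d : ℕ} [NeZero d] (P Q : Finset (Fin n)) :
    assemble P Q 0 0 0 = (0 : Fin n → Fin d) := by
  ext s : 1
  simp [assemble]

theorem assemble_single_left {n d : ℕ} [NeZero d] (P Q : Finset (Fin n)) (s : P) (i : Fin d) :
    assemble P Q (Pi.single s i) 0 0 = Pi.single (s : Fin n) i := by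
  ext t : 1
  by_cases ht : t = s
  · subst ht; simp [assemble]
  · have : ∀ h : t ∈ P, (⟨t, h⟩ : P) ≠ s := fun h e => ht (congrArg Subtype.val e)
    by_cases hP : t ∈ P
    · simp [assemble, hP, Pi.single_eq_of_ne ht, Pi.single_eq_of_ne (this hP)]
    · simp [assemble, hP, Pi.single_eq_of_ne ht]

theorem assemble_single_right {n d : ℕ} [NeZero d] {P Q : Finset (Fin n)} (hPQ : Disjoint P Q)
    (s : Q) (i : Fin d) :
    assemble P Q 0 (Pi.single s i) 0 = Pi.single (s : Fin n) i := by
  ext t : 1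
  by_cases ht : t = s
  · subst ht; simp [assemble, Finset.disjoint_right.1 hPQ s.2]
  · have : ∀ h : t ∈ Q, (⟨t, h⟩ : Q) ≠ s := fun h e => ht (congrArg Subtype.val e)
    by_cases hQ : t ∈ Q
    · simp [assemble, hQ, Pi.single_eq_of_ne ht, Pi.single_eq_of_ne (this hQ)]
    · simp [assemble, hQ, Pi.single_eq_of_ne ht]

theorem assemble_single_rest {n d : ℕ} [NeZero d] (P Q : Finset (Fin n))
    (s : {s : Fin n // s ∉ P ∪ Q}) (i : Fin d) :
    assemble P Q 0 0 (Pi.single s i) = Pi.single (s : Fin n) i := by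
  have h1 : (s : Fin n) ∉ P := fun h => s.2 (Finset.mem_union_left _ h)
  have h2 : (s : Fin n) ∉ Q := fun h => s.2 (Finset.mem_union_right _ h)
  ext t : 1
  by_cases ht : t = s
  · subst ht; simp [assemble, h1, h2]
  · by_cases hP : t ∈ P
    · simp [assemble, hP, Pi.single_eq_of_ne ht]
    by_cases hQ : t ∈ Q
    · simp [assemble, hQ, Pi.single_eq_of_ne ht]
    have : (⟨t, by simp [hP, hQ]⟩ : {s : Fin n // s ∉ P ∪ Q}) ≠ s :=
      fun e => ht (congrArg Subtype.val e)
    simp [assemble, hP, hQ, Pi.single_eq_of_ne ht, Pi.single_eq_of_ne this]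

theorem sum_eq_sum_parts {n : ℕ} {M : Type*} [AddCommMonoid M] {P Q : Finset (Fin n)}
    (hPQ : Disjoint P Q) (F : Fin n → M) :
    ∑ s, F s = ∑ s : P, F s + ∑ s : Q, F s + ∑ s : {s : Fin n // s ∉ P ∪ Q}, F s := by
  rw [← Finset.sum_add_sum_compl (P ∪ Q), Finset.sum_union hPQ, ← Finset.sum_coe_sort P,
    ← Finset.sum_coe_sort Q, Finset.sum_subtype (p := fun s => s ∉ P ∪ Q) (P ∪ Q)ᶜ (by simp) F]

/-- The amplitudes of `|W⟩ + b|0⟩` with respect to a tripartition of the parties. -/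
theorem gwVector_add_vacuum_assemble {n d : ℕ} [NeZero d] (a : Fin n → Fin d → ℂ) (b : ℂ)
    {P Q : Finset (Fin n)} (hPQ : Disjoint P Q) (u : (P → Fin d) × (Q → Fin d))
    (z : {s : Fin n // s ∉ P ∪ Q} → Fin d) :
    (gwVector a + b • vacuum n d) (assemble P Q u.1 u.2 z) =
      (if z = 0 then wVec (wConfig fun s : P => a s) (wConfig fun s : Q => a s) b u else 0) +
        wVec (0 : (P → Fin d) → ℂ) (0 : (Q → Fin d) → ℂ) 1 u *
          wConfig (fun s : {s : Fin n // s ∉ P ∪ Q} => a s) z := by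
  obtain ⟨x, y⟩ := u
  have hg : gwVector a (assemble P Q x y z) = ∑ s : Fin n,
      ∑ i ∈ Finset.univ.filter (fun i : Fin d => i ≠ 0),
        if assemble P Q x y z = Pi.single s i then a s i else 0 := by
    rw [gwVector, Finset.sum_comm]
    simp [Finset.sum_apply, Pi.single_apply]
  have hv : vacuum n d (assemble P Q x y z) = if x = 0 ∧ y = 0 ∧ z = 0 then 1 else 0 := by
    simp only [vacuum, Pi.single_apply, ← assemble_zero P Q, assemble_inj hPQ]
  have hP : ∀ (s : P) (i : Fin d), (assemble P Q x y z = Pi.single (s : Fin n) i) ↔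
      (x = Pi.single s i ∧ y = 0 ∧ z = 0) := fun s i => by
    rw [← assemble_single_left P Q, assemble_inj hPQ]
  have hQ : ∀ (s : Q) (i : Fin d), (assemble P Q x y z = Pi.single (s : Fin n) i) ↔
      (x = 0 ∧ y = Pi.single s i ∧ z = 0) := fun s i => by
    rw [← assemble_single_right hPQ, assemble_inj hPQ]
  have hZ : ∀ (s : {s : Fin n // s ∉ P ∪ Q}) (i : Fin d),
      (assemble P Q x y z = Pi.single (s : Fin n) i) ↔
      (x = 0 ∧ y = 0 ∧ z = Pi.single s i) := fun s i => by
    rw [← assemble_single_rest P Q, assemble_inj hPQ]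
  rw [Pi.add_apply, Pi.smul_apply, hg, hv, sum_eq_sum_parts hPQ]
  simp only [hP, hQ, hZ, wVec, wConfig]
  by_cases hx : x = 0 <;> by_cases hy : y = 0 <;> by_cases hz : z = 0 <;> simp [hx, hy, hz]
  all_goals ring

theorem reducedState_eq_wState {n d : ℕ} [NeZero d] (a : Fin n → Fin d → ℂ) (b : ℂ)
    {P Q : Finset (Fin n)} (hPQ : Disjoint P Q) :
    reducedState (gwVector a + b • vacuum n d) P Q =
      wState (wConfig fun s : P => a s) (wConfig fun s : Q => a s) b
        (∑ s ∈ (P ∪ Q)ᶜ, partyWeight a s) := by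
  have hc : ∑ s ∈ (P ∪ Q)ᶜ, partyWeight a s =
      sumNormSq (wConfig fun s : {s : Fin n // s ∉ P ∪ Q} => a s) := by
    rw [sumNormSq_wConfig, Finset.sum_subtype (p := fun s => s ∉ P ∪ Q) (P ∪ Q)ᶜ (by simp)]
    rfl
  ext u v
  simp only [reducedState, Matrix.of_apply, gwVector_add_vacuum_assemble a b hPQ, wState,
    Matrix.add_apply, Matrix.smul_apply, Matrix.vecMulVec_apply, Pi.star_apply, smul_eq_mul]
  rw [hc, ← star_dotProduct_self, dotProduct, Finset.sum_mul]
  generalize wVec (wConfig fun s : P => a s) (wConfig fun s : Q => a s) b u = A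
  generalize wVec (wConfig fun s : P => a s) (wConfig fun s : Q => a s) b v = A'
  generalize wVec (0 : (P → Fin d) → ℂ) (0 : (Q → Fin d) → ℂ) 1 u = E
  generalize wVec (0 : (P → Fin d) → ℂ) (0 : (Q → Fin d) → ℂ) 1 v = E'
  -- The traced-out configuration `z = 0` carries the W-type vector; every `z ≠ 0` carries only the
  -- vacuum. `wConfig` vanishes at `0`, so no cross terms appear.
  rw [show A * star A' = ∑ z : {s : Fin n // s ∉ P ∪ Q} → Fin d,
    if z = 0 then A * star A' else 0 by simp, ← Finset.sum_add_distrib]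
  refine Finset.sum_congr rfl fun z _ => ?_
  by_cases hz : z = 0
  · simp [hz, wConfig_zero]
  · simp only [hz, if_false, zero_add, star_mul', Pi.star_apply]
    ring

/-- The factor `√p` is absorbed into the amplitudes; unit length reappears through the members of
each decomposition. -/
theorem IsGWV.exists_eq {n d : ℕ} [NeZero d] {ψ : (Fin n → Fin d) → ℂ} (h : IsGWV ψ) :
    ∃ (a : Fin n → Fin d → ℂ) (b : ℂ), ψ = gwVector a + b • vacuum n d := by
  obtain ⟨p, a, -, -, -, rfl⟩ := h
  refine ⟨((√p : ℝ) : ℂ) • a, ((√(1 - p) : ℝ) : ℂ), ?_⟩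
  congr 1
  simp [gwVector, Finset.smul_sum, smul_smul]

theorem sumNormSq_wConfig_coe {n d : ℕ} [NeZero d] (a : Fin n → Fin d → ℂ) (P : Finset (Fin n)) :
    sumNormSq (wConfig fun s : P => a s) = ∑ s ∈ P, partyWeight a s := by
  rw [sumNormSq_wConfig, ← Finset.sum_coe_sort P]
  rfl

theorem Tqa_nonneg {n d : ℕ} [NeZero d] {ψ : (Fin n → Fin d) → ℂ} (hψ : IsGWV ψ) {q : ℝ}
    (hq : 0 < q) {P Q : Finset (Fin n)} (hPQ : Disjoint P Q) : 0 ≤ Tqa q ψ P Q := by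
  obtain ⟨a, b, rfl⟩ := hψ.exists_eq
  rw [Tqa, reducedState_eq_wState a b hPQ]
  exact tsallisAssist_wState_nonneg _ _ hq (wConfig_zero _) (wConfig_zero _)

theorem Tqa_union_le_add {n d : ℕ} [NeZero d] {ψ : (Fin n → Fin d) → ℂ} (hψ : IsGWV ψ) {q : ℝ}
    (hq0 : 0 < q) (hq : q ≤ 2 ∨ 3 ≤ q) {P Q R : Finset (Fin n)} (hPQ : Disjoint P Q)
    (hPR : Disjoint P R) (hQR : Disjoint Q R) :
    Tqa q ψ P (Q ∪ R) ≤ Tqa q ψ P Q + Tqa q ψ P R := by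
  obtain ⟨a, b, rfl⟩ := hψ.exists_eq
  -- Tracing out `T` as well moves its weight into the vacuum.
  have hc : ∀ {S T : Finset (Fin n)}, Disjoint P S → Disjoint P T → Disjoint S T →
      ∑ s ∈ (P ∪ S)ᶜ, partyWeight a s =
        ∑ s ∈ (P ∪ (S ∪ T))ᶜ, partyWeight a s + ∑ s ∈ T, partyWeight a s := by
    intro S T hS hT hST
    have h1 := Finset.sum_add_sum_compl (P ∪ S) (partyWeight a)
    have h2 := Finset.sum_add_sum_compl (P ∪ S ∪ T) (partyWeight a)
    rw [Finset.sum_union (Finset.disjoint_union_left.2 ⟨hT, hST⟩)] at h2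
    rw [← Finset.union_assoc]
    linarith
  have h := tsallisAssist_wState_le_add (w := wConfig fun s : P => a s)
    (v := wConfig fun s : ↥(Q ∪ R) => a s) (v₁ := wConfig fun s : Q => a s)
    (v₂ := wConfig fun s : R => a s) b (∑ s ∈ (P ∪ (Q ∪ R))ᶜ, partyWeight a s) hq0 hq
    (wConfig_zero _) (wConfig_zero _) (wConfig_zero _) (wConfig_zero _)
    (by simp only [sumNormSq_wConfig_coe, Finset.sum_union hQR])
  rw [sumNormSq_wConfig_coe, sumNormSq_wConfig_coe, ← hc hPQ hPR hQR, Finset.union_comm Q R,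
    ← hc hPR hPQ hQR.symm, Finset.union_comm R Q] at h
  rw [Tqa, Tqa, Tqa, reducedState_eq_wState a b (Finset.disjoint_union_right.2 ⟨hPQ, hPR⟩),
    reducedState_eq_wState a b hPQ, reducedState_eq_wState a b hPR]
  exact h

/-! ### Iteration along the chain of blocks. -/

theorem tailUnion_eq_union {n : ℕ} {r i : ℕ} (Q : ℕ → Finset (Fin n)) (h : i < r) :
    tailUnion r Q i = Q i ∪ tailUnion r Q (i + 1) := by
  rw [tailUnion, ← Finset.insert_Ico_add_one_left_eq_Ico h, Finset.biUnion_insert, tailUnion]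

/-- If `S i ≤ T i + S (i + 1)` and `T` dominates the tail at the first `t + 1` steps, these steps
contribute the weights `1, K, …, K ^ t`. -/
theorem rpow_le_sum_of_tail_le {S T : ℕ → ℝ} {k μ : ℝ} (hk : 0 < k) (hμ : 0 < μ) (hμ1 : μ ≤ 1)
    (m : ℕ) (hS : ∀ i ≤ m, 0 ≤ S i) (hT : ∀ i < m, 0 ≤ T i)
    (hST : ∀ i < m, S i ≤ T i + S (i + 1)) (h : ∀ i < m, S (i + 1) ≤ k * T i) :
    S 0 ^ μ ≤ ∑ j ∈ Finset.range m, Kweight k μ ^ j * T j ^ μ + Kweight k μ ^ m * S m ^ μ := by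
  induction m with
  | zero => simp
  | succ m ih =>
    refine (ih (fun i hi => hS i (by omega)) (fun i hi => hT i (by omega))
      (fun i hi => hST i (by omega)) (fun i hi => h i (by omega))).trans ?_
    rw [Finset.sum_range_succ, add_assoc, pow_succ, mul_assoc, ← mul_add]
    refine add_le_add le_rfl
      (mul_le_mul_of_nonneg_left ?_ (pow_nonneg (Kweight_nonneg hk hμ) m))
    exact (Real.rpow_le_rpow (hS m (by omega)) (hST m (by omega)) hμ.le).trans
      (add_rpow_le_add_Kweight hk hμ hμ1 (hT m (by omega)) (hS (m + 1) le_rfl) (h m (by omega)))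

/-- If `S i ≤ T i + S (i + 1)` and the tail dominates `T`, every step has weight `K`. -/
theorem rpow_le_sum_of_le_tail {S T : ℕ → ℝ} {k μ : ℝ} (hk : 0 < k) (hμ : 0 < μ) (hμ1 : μ ≤ 1)
    {a b : ℕ} (hab : a ≤ b) (hS : ∀ i ≤ b, 0 ≤ S i) (hT : ∀ i < b, 0 ≤ T i)
    (hST : ∀ i < b, S i ≤ T i + S (i + 1)) (h : ∀ i ∈ Finset.Ico a b, T i ≤ k * S (i + 1)) :
    S a ^ μ ≤ Kweight k μ * ∑ j ∈ Finset.Ico a b, T j ^ μ + S b ^ μ := by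
  induction b, hab using Nat.le_induction with
  | base => simp
  | succ b hab ih =>
    refine (ih (fun i hi => hS i (by omega)) (fun i hi => hT i (by omega))
      (fun i hi => hST i (by omega)) (fun i hi => h i (by
        rw [Finset.mem_Ico] at hi ⊢; omega))).trans ?_
    rw [Finset.sum_Ico_succ_top hab, mul_add, add_assoc]
    refine add_le_add le_rfl ?_
    refine (Real.rpow_le_rpow (hS b (by omega)) (hST b (by omega)) hμ.le).trans ?_
    rw [add_comm (T b), add_comm (_ * _)]
    exact add_rpow_le_add_Kweight hk hμ hμ1 (hS (b + 1) le_rfl) (hT b (by omega))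
      (h b (by rw [Finset.mem_Ico]; omega))

theorem theorem7 {n d : ℕ} [NeZero d] (hd : 2 ≤ d)
    (ψ : (Fin n → Fin d) → ℂ) (hψ : IsGWV ψ)
    (r : ℕ) (hr : 3 ≤ r)
    -- pairwise disjoint nonempty blocks `P, Q 0, …, Q (r-1)` of parties
    (P : Finset (Fin n)) (Q : ℕ → Finset (Fin n))
    (hP : P.Nonempty) (hQ : ∀ j < r, (Q j).Nonempty)
    (hPQ : ∀ j < r, Disjoint P (Q j))
    (hQQ : ∀ i < r, ∀ j < r, i ≠ j → Disjoint (Q i) (Q j))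
    (q : ℝ) (hq : q ∈ Set.Icc ((5 - √13) / 2) 2 ∪ Set.Icc 3 ((5 + √13) / 2))
    (μ : ℝ) (hμ0 : 0 < μ) (hμ1 : μ ≤ 1)
    (k : ℝ) (hk0 : 0 < k) (hk1 : k ≤ 1)
    (t : ℕ) (ht : t ≤ r - 3)
    (h₁ : ∀ i ∈ Finset.Icc 0 t, Tqa q ψ P (tailUnion r Q (i + 1)) ≤ k * Tqa q ψ P (Q i))
    (h₂ : ∀ j ∈ Finset.Icc (t + 1) (r - 2),
      Tqa q ψ P (Q j) ≤ k * Tqa q ψ P (tailUnion r Q (j + 1))) :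
    Tqa q ψ P (tailUnion r Q 0) ^ μ ≤
      (∑ j ∈ Finset.Icc 0 t, Kweight k μ ^ j * Tqa q ψ P (Q j) ^ μ)
        + Kweight k μ ^ (t + 2) * (∑ j ∈ Finset.Icc (t + 1) (r - 2), Tqa q ψ P (Q j) ^ μ)
        + Kweight k μ ^ (t + 1) * Tqa q ψ P (Q (r - 1)) ^ μ := by
  have h13 : √13 < 5 := by
    rw [Real.sqrt_lt' (by norm_num)]; norm_num
  have hq0 : 0 < q := by
    rcases hq with h | h <;> linarith [h.1]
  have hq' : q ≤ 2 ∨ 3 ≤ q := hq.imp (fun h => h.2) fun h => h.1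
  have hPt : ∀ i, Disjoint P (tailUnion r Q i) := fun i => by
    rw [tailUnion, Finset.disjoint_biUnion_right]
    exact fun j hj => hPQ j (Finset.mem_Ico.1 hj).2
  have hQt : ∀ i < r, Disjoint (Q i) (tailUnion r Q (i + 1)) := fun i hi => by
    rw [tailUnion, Finset.disjoint_biUnion_right]
    intro j hj
    rw [Finset.mem_Ico] at hj
    exact hQQ i hi j hj.2 (by omega)
  have hS : ∀ i, 0 ≤ Tqa q ψ P (tailUnion r Q i) := fun i => Tqa_nonneg hψ hq0 (hPt i)
  have hT : ∀ i < r, 0 ≤ Tqa q ψ P (Q i) := fun i hi => Tqa_nonneg hψ hq0 (hPQ i hi)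
  have hST : ∀ i < r, Tqa q ψ P (tailUnion r Q i) ≤
      Tqa q ψ P (Q i) + Tqa q ψ P (tailUnion r Q (i + 1)) := fun i hi => by
    rw [tailUnion_eq_union Q hi]
    exact Tqa_union_le_add hψ hq0 hq' (hPQ i hi) (hPt _) (hQt i hi)
  have hlast : tailUnion r Q (r - 1) = Q (r - 1) := by
    rw [tailUnion_eq_union Q (by omega), Nat.sub_add_cancel (by omega)]
    simp [tailUnion]
  -- Peeling blocks `0, …, t` leaves `K^(t+1)` in front of the tail starting at `t + 1`.
  have hfirst := rpow_le_sum_of_tail_le (S := fun i => Tqa q ψ P (tailUnion r Q i))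
    (T := fun i => Tqa q ψ P (Q i)) hk0 hμ0 hμ1 (t + 1) (fun i _ => hS i)
    (fun i hi => hT i (by omega)) (fun i hi => hST i (by omega))
    (fun i hi => h₁ i (Finset.mem_Icc.2 ⟨i.zero_le, by omega⟩))
  -- From here the tail is the dominant term, so each block gets one `K` and the tail none. The
  -- chain stops at `r - 1`, where the tail is the single block `Q (r - 1)`; multiplying by
  -- `K^(t+1)` gives the exponents `t + 2` and `t + 1`.
  have hsecond := rpow_le_sum_of_le_tail (S := fun i => Tqa q ψ P (tailUnion r Q i))
    (T := fun i => Tqa q ψ P (Q i)) hk0 hμ0 hμ1 (show t + 1 ≤ r - 1 by omega) (fun i _ => hS i)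
    (fun i hi => hT i (by omega)) (fun i hi => hST i (by omega))
    (fun i hi => h₂ i (by rw [Finset.mem_Ico] at hi; rw [Finset.mem_Icc]; omega))
  simp only [hlast] at hfirst hsecond
  have e1 : Finset.Icc 0 t = Finset.range (t + 1) := by ext; simp
  have e2 : Finset.Icc (t + 1) (r - 2) = Finset.Ico (t + 1) (r - 1) := by ext; simp; omega
  rw [e1, e2]
  refine hfirst.trans ?_
  rw [add_assoc]
  refine add_le_add le_rfl ?_
  refine (mul_le_mul_of_nonneg_left hsecond (pow_nonneg (Kweight_nonneg hk0 hμ0) _)).trans_eq ?_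
  ring
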